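/- Theorem 1 (Order-Wise Reduction). Consider D2D coded caching with $K$ users, $N\ge 1$ equally long files and cache size $M$ files per user, where $t = KM/N$ is a positive integer. In a scheme with subpacketization $F$, every file is split into $F$ equal-sized packets, every user stores uncoded at most $MF$ packets before the demands are known, and then each broadcast message is an XOR of packets stored by its sender; the scheme has rate $R$ if, for every demand vector $(d_1,\dots,d_K)\in[N]^K$, $RF$ messages of packet length are sent and every user $k$ recovers file $d_k$ from its cache and the messages. Let $\bar t = K-t$ and $F_{\rm JCM} = t\binom{K}{t}$ (the subpacketization of the Ji-Caire-Molisch scheme). A packet type (PT) design is given by a partition of the $K$ users into groups and a choice of transmitters. The type of a set of users is the unordered list of its intersection sizes with the groups (recorded together with the group sizes). For every type of $(t+1)$-subsets $S$ (multicast groups), the set $U_S\subseteq S$ of transmitters is selected, where users of $S$ whose groups have the same size and meet $S$ in equally many users are either all selected or all not selected, and this choice depends only on the type of $S$. The global further splitting vector $\alpha\neq0$ assigns to each type of $t$-subsets a nonnegative integer such that, for suitable nonnegative integers $z_s$, $\alpha(\mathrm{type}(S\setminus\{k\})) = z_{\mathrm{type}(S)}\,|U_S\setminus\{k\}|$ for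 all $S$ and $k\in S$, and it is the componentwise least such vector with the same zero entries. The subpacketization of the design is $F_{\rm PT}=\sum_{T}\alpha(\mathrm{type}(T))$, summed over all $t$-subsets $T$ of the users: each file is split into packets $W^{(i)}_{n,T}$, $1\le i\le\alpha(\mathrm{type}(T))$, and user $k$ stores those with $k\in T$. In each $S$, every transmitter $k\in U_S$ sends $z_{\mathrm{type}(S)}$ messages, each the XOR, over $j\in S\setminus\{k\}$, of one packet of $W_{d_j,S\setminus\{j\}}$, the packets of $W_{d_j,S\setminus\{j\}}$ being used in turn, each exactly once. For all $K,t$ such that $K$ and $\bar t$ are even, $K\ge 4$ and $\bar t\le K/2$, there is a PT design, depending only on $K$ and $t$, with the users grouped into $K/2$ pairs, whose scheme achieves, for all $N$ and $M$ with $KM/N=t$, the rate $R = N/M-1$ with a subpacketization $F_{\rm PT}=F_{\rm PT}(K,t)$ such that $F_{\rm PT}\le F_{\rm JCM}$ and $$\frac{F_{\rm PT}}{F_{\rm JCM}} \le \min\Big\{\frac1t\prod_{i=1}^{\bar t/2}(2i-1),\,1\Big\}.$$ Moreover, for these designs, $F_{\rm PT}/F_{\rm JCM}\to 0$ as $K\to\infty$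 (along any sequence of such pairs $(K,t)$) if $\mu = M/N = t/K$ satisfies $1-\mu = O\big(\frac{\log_2\log_2 K}{K}\big)$, that is, if $\bar t=O(\log_2\log_2K)$. -/

import Mathlib

open Filter Asymptotics Finset
open scoped Topology BigOperators

/-! ## Device-to-device (D2D) coded caching with uncoded placement -/

/-- A D2D caching scheme for `K` users and `N` files.  Every file is split into equally long
packets, labelled by the elements of `packets`; a pair `(n, p)` stands for packet `p` of file `n`.
Every coded message is the XOR of some packets and is broadcast by one user to all others. -/
structure D2DScheme (K N : ℕ) (ι κ : Type) where
  /-- labels of the packets of each file -/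
  packets : Finset ι
  /-- the packets stored by each user (chosen before the demands are known) -/
  cache : Fin K → Finset (Fin N × ι)
  /-- the coded messages sent when user `k` wants file `d k` -/
  msgs : (Fin K → Fin N) → Finset κ
  /-- the user that sends a given message -/
  sender : κ → Fin K
  /-- the packets that are XORed in a given message -/
  content : (Fin K → Fin N) → κ → Finset (Fin N × ι)

/-- The value of a coded message (a vector of `b` bits) for the library `W`, whose packets are
`b` bits long each. -/
def D2DScheme.value {K N : ℕ} {ι κ : Type} (σ : D2DScheme K N ι κ) {b : ℕ}
    (W : Fin N → ι → (Fin b → ZMod 2)) (d : Fin K → Fin N) (μ : κ) : Fin b → ZMod 2 :=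
  ∑ p ∈ σ.content d μ, W p.1 p.2

/-- The scheme `σ` is valid with cache size `M` (in files), has subpacketization `F` and
communication rate `R` for every demand vector.  With packets of `b` bits a file has `L = F * b`
bits, a cache may hold `M * L` bits, and the rate is the number of sent bits divided by `L`. -/
structure D2DScheme.Achieves {K N : ℕ} {ι κ : Type} (σ : D2DScheme K N ι κ)
    (M R : ℝ) (F : ℕ) : Prop where
  pos : 0 < F
  /-- every file is split into `F` packets -/
  card_packets : #σ.packets = F
  /-- the users store actual packets -/
  cache_subset : ∀ k, σ.cache k ⊆ univ ×ˢ σ.packets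
  /-- memory constraint -/
  memory : ∀ k, (#(σ.cache k) : ℝ) ≤ M * F
  /-- a user can only send what it can compute from its own cache -/
  sendable : ∀ d, ∀ μ ∈ σ.msgs d, σ.content d μ ⊆ σ.cache (σ.sender μ)
  /-- for every content of the library, the cache of a user and the sent messages together
  determine the file that the user wants -/
  decodable : ∀ (d : Fin K → Fin N) (b : ℕ) (W W' : Fin N → ι → (Fin b → ZMod 2)) (k : Fin K),
    (∀ p ∈ σ.cache k, W p.1 p.2 = W' p.1 p.2) →
    (∀ μ ∈ σ.msgs d, σ.value W d μ = σ.value W' d μ) →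
    ∀ p ∈ σ.packets, W (d k) p = W' (d k) p
  /-- communication rate -/
  rate : ∀ d, (#(σ.msgs d) : ℝ) = R * F

/-- The subpacketization of the Ji-Caire-Molisch scheme. -/
def FJCM (K t : ℕ) : ℕ := t * K.choose t

/-! ## Packet type-based (PT) designs -/

section PT

variable {K m : ℕ}

/-- The users of group `g` that belong to `B`. -/
def groupPart (Q : Fin K → Fin m) (B : Finset (Fin K)) (g : Fin m) : Finset (Fin K) :=
  B.filter fun k => Q k = g

/-- The size of group `g`, together with the size of its intersection with `B`. -/
def groupProfile (Q : Fin K → Fin m) (B : Finset (Fin K)) (g : Fin m) : ℕ × ℕ :=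
  (#(groupPart Q univ g), #(groupPart Q B g))

/-- The type of a set `B` of users under the grouping `Q`: the unordered list, over all groups, of
the intersection sizes.  The group sizes are recorded as well, which only matters for groups of
unequal sizes. -/
def setType (Q : Fin K → Fin m) (B : Finset (Fin K)) : Multiset (ℕ × ℕ) :=
  (univ : Finset (Fin m)).val.map (groupProfile Q B)

/-- The subfile types: the types of the `t`-subsets of the user set. -/
def subfileTypes (Q : Fin K → Fin m) (t : ℕ) : Finset (Multiset (ℕ × ℕ)) :=
  (powersetCard t univ).image (setType Q)

/-- `F(v)`: the number of subfiles of type `v`. -/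
def numSubfiles (Q : Fin K → Fin m) (t : ℕ) (v : Multiset (ℕ × ℕ)) : ℕ :=
  #((powersetCard t univ).filter fun T => setType Q T = v)

/-- The transmitters in a multicast group `S`.  The unique sets of `S` are the sets of those
users of `S` whose groups have the same profile; `Tx` selects, for each multicast group type,
the unique sets (given by their profiles) whose users transmit. -/
def transmitters (Q : Fin K → Fin m) (Tx : Multiset (ℕ × ℕ) → Finset (ℕ × ℕ))
    (S : Finset (Fin K)) : Finset (Fin K) :=
  S.filter fun k => groupProfile Q S (Q k) ∈ Tx (setType Q S)

/-- The local further splitting factor, in the multicast group `S`, of the subfiles with label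
`S \ {k}`: the number of transmitters of `S` other than `k`. -/
def localFS (Q : Fin K → Fin m) (Tx : Multiset (ℕ × ℕ) → Finset (ℕ × ℕ))
    (S : Finset (Fin K)) (k : Fin K) : ℕ :=
  #((transmitters Q Tx S).erase k)

/-- `α` is a common multiple of the local further splitting vectors, with the multiplier `z s` for
the multicast group type `s`.  A subfile type `v` with `α v = 0` is excluded; a multicast group
type `s` with `z s = 0` is not served. -/
def IsCommonMultiple (Q : Fin K → Fin m) (t : ℕ) (Tx : Multiset (ℕ × ℕ) → Finset (ℕ × ℕ))
    (α z : Multiset (ℕ × ℕ) → ℕ) : Prop :=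
  ∀ S : Finset (Fin K), #S = t + 1 → ∀ k ∈ S,
    α (setType Q (S.erase k)) = z (setType Q S) * localFS Q Tx S k

end PT

/-- A PT design for `K` users and aggregate memory `t`: a grouping of the users into nonempty
groups, a selection of transmitters for each multicast group type, and the resulting global
further splitting vector `α`, the vector least common multiple of the local ones. -/
structure PTDesign (K t : ℕ) where
  /-- number of user groups -/
  m : ℕ
  /-- the group of each user -/
  Q : Fin K → Fin m
  Q_surjective : Function.Surjective Q
  /-- selection of transmitters for each multicast group type -/
  Tx : Multiset (ℕ × ℕ) → Finset (ℕ × ℕ)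
  /-- global further splitting factors -/
  α : Multiset (ℕ × ℕ) → ℕ
  /-- multipliers -/
  z : Multiset (ℕ × ℕ) → ℕ
  common : IsCommonMultiple Q t Tx α z
  /-- not all subfile types are excluded -/
  nontrivial : ∃ v ∈ subfileTypes Q t, α v ≠ 0
  /-- `α` is least among the common multiples that exclude the same subfile types -/
  least : ∀ β w : Multiset (ℕ × ℕ) → ℕ, IsCommonMultiple Q t Tx β w →
    (∀ v ∈ subfileTypes Q t, β v = 0 ↔ α v = 0) → ∀ v ∈ subfileTypes Q t, α v ≤ β v

namespace PTDesign

variable {K t : ℕ}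

/-- All groups consist of two users. -/
def IsPairing (D : PTDesign K t) : Prop :=
  ∀ g : Fin D.m, #(groupPart D.Q univ g) = 2

/-- The subpacketization of a PT design: the sum of `α v * F(v)` over the subfile types `v`. -/
def FPT (D : PTDesign K t) : ℕ :=
  ∑ v ∈ subfileTypes D.Q t, D.α v * numSubfiles D.Q t v

/-- The number of transmitters of `S` other than `j` that have sent before user `k`, when the
transmitters send in increasing order: the number of concatenated packets with label `S \ {j}`
used before the turn of `k`. -/
def counter (D : PTDesign K t) (S : Finset (Fin K)) (k j : Fin K) : ℕ :=
  #(((transmitters D.Q D.Tx S).erase j).filter fun i => i < k)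

/-- The caching scheme of a PT design.  The packets of a file are labelled by `⟨T, i⟩` with `T` a
`t`-subset of the users and `i < α (type T)`; user `k` stores those with `k ∈ T`.  In every
multicast group `S` with multiplier `z`, every transmitter `k` sends, for each `i < z`, the XOR
over `j ∈ S \ {k}` of the packet `⟨S \ {j}, counter * z + i⟩` of the file wanted by `j`. -/
def scheme (D : PTDesign K t) (N : ℕ) :
    D2DScheme K N ((_ : Finset (Fin K)) × ℕ) ((_ : Finset (Fin K)) × (Fin K × ℕ)) where
  packets := (powersetCard t univ).sigma fun T => range (D.α (setType D.Q T))
  cache k := univ ×ˢ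
    (((powersetCard t univ).filter fun T => k ∈ T).sigma fun T => range (D.α (setType D.Q T)))
  msgs _ := (powersetCard (t + 1) univ).sigma fun S =>
    transmitters D.Q D.Tx S ×ˢ range (D.z (setType D.Q S))
  sender μ := μ.2.1
  content d μ := (μ.1.erase μ.2.1).image fun j =>
    (d j, ⟨μ.1.erase j, D.counter μ.1 μ.2.1 j * D.z (setType D.Q μ.1) + μ.2.2⟩)

end PTDesign

/-- The parameters considered: `t + tbar = K`, both `K` and `tbar` even, `4 ≤ K`,
`tbar ≤ K / 2`. -/
def Admissible (K t tbar : ℕ) : Prop :=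
  t + tbar = K ∧ Even K ∧ Even tbar ∧ 4 ≤ K ∧ 2 * tbar ≤ K

/-! ## The scheme of a PT design -/

namespace PTDesign

variable {K t : ℕ}

/-! Every PT design yields a decodable scheme of rate `(K - t) / t` (`card_msgs`, `decodable`), and
if the grouping has a transitive symmetry group, all caches are equally large and meet the memory
bound exactly (`card_cache`). Only the subpacketization depends on the design.

On pairs, two designs are compared. If everybody transmits, all local factors equal `t`, so each
file is split as in the Ji-Caire-Molisch scheme. If only users without their partner transmit,
parity forces a multicast group to contain `2j+1` of them. Removing one of these leaves a label with
`2j` single users and local factor `2j`; removing a paired user leaves a label with `2j+2` single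
users and local factor `2j+1`. Hence the splitting factors obey `a j = z j * 2j` and `a (j+1) = z j
* (2j+1)`. They increase with `j`, and a solution ends in the product of the first `tbar/2` odd
numbers (`exists_splitting_sequence`), which bounds the least solution. The latter exists because
any two solutions are proportional (`exists_ratio`, `IsCommonMultiple.exists_least`).
`exists_design` takes whichever of the two designs has the smaller bound.

For the limit, the product is at most `2 ^ tbar ^ 2`. With `tbar = O(log log K)` this is eventually
at most `√K`, while `t ≥ K/2`. -/

lemma FPT_eq_sum (D : PTDesign K t) :
    D.FPT = ∑ T ∈ powersetCard t univ, D.α (setType D.Q T) := by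
  unfold FPT numSubfiles subfileTypes
  rw [← sum_fiberwise_of_maps_to (g := setType D.Q)
    (fun T hT => mem_image_of_mem (setType D.Q) hT)]
  refine sum_congr rfl fun v _ => ?_
  rw [sum_congr rfl (g := fun _ => D.α v) (fun T hT => by rw [(mem_filter.1 hT).2]), sum_const,
    smul_eq_mul, mul_comm]

lemma card_packets (D : PTDesign K t) (N : ℕ) : #(D.scheme N).packets = D.FPT := by
  simp [scheme, card_sigma, FPT_eq_sum]

lemma FPT_pos (D : PTDesign K t) : 0 < D.FPT := by
  obtain ⟨v, hv, h0⟩ := D.nontrivial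
  obtain ⟨T, hT, rfl⟩ := mem_image.1 hv
  rw [FPT_eq_sum]
  exact sum_pos' (fun _ _ => Nat.zero_le _) ⟨T, hT, Nat.pos_of_ne_zero h0⟩

/-- Summing over pairs of a `(t+1)`-set and one of its elements is summing over pairs of a `t`-set
and an element outside of it. -/
lemma sum_sum_erase {V : Type*} [Fintype V] [DecidableEq V] (t : ℕ) (f : Finset V → ℕ) :
    ∑ S ∈ powersetCard (t + 1) univ, ∑ k ∈ S, f (S.erase k) =
      (Fintype.card V - t) * ∑ T ∈ powersetCard t univ, f T := by
  have h : ∀ T ∈ powersetCard t (univ : Finset V),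
      (Fintype.card V - t) * f T = ∑ _k ∈ Tᶜ, f T := by
    intro T hT
    rw [sum_const, card_compl, (mem_powersetCard.1 hT).2, smul_eq_mul]
  rw [mul_sum, sum_congr rfl h, sum_sigma', sum_sigma']
  refine sum_bij' (fun x _ => ⟨x.1.erase x.2, x.2⟩) (fun x _ => ⟨insert x.2 x.1, x.2⟩)
    ?_ ?_ ?_ ?_ ?_
  · rintro ⟨S, k⟩ h
    simp only [mem_sigma, mem_powersetCard, subset_univ, true_and, mem_compl] at h ⊢
    simp [card_erase_of_mem h.2, h.1]
  · rintro ⟨S, k⟩ h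
    simp only [mem_sigma, mem_powersetCard, subset_univ, true_and, mem_compl] at h ⊢
    simp [card_insert_of_notMem h.2, h.1]
  · rintro ⟨S, k⟩ h
    simp only [mem_sigma] at h
    simp [insert_erase h.2]
  · rintro ⟨S, k⟩ h
    simp only [mem_sigma, mem_compl] at h
    simp [erase_insert h.2]
  · rintro ⟨S, k⟩ h
    rfl

/-- Double counting of pairs `(S, k)` with `k ∈ S`, weighted by the splitting factor of `S \ {k}`.
This fixes the rate of every PT design, whatever its grouping and transmitters. -/
lemma card_msgs (D : PTDesign K t) (N : ℕ) (d : Fin K → Fin N) :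
    t * #((D.scheme N).msgs d) = (K - t) * D.FPT := by
  have h1 := sum_sum_erase t fun T => D.α (setType D.Q T)
  rw [Fintype.card_fin] at h1
  rw [FPT_eq_sum, ← h1]
  simp only [scheme, card_sigma, card_product, card_range, mul_sum]
  refine sum_congr rfl fun S hS => ?_
  have hS := (mem_powersetCard.1 hS).2
  rw [sum_congr rfl (fun k hk => D.common S hS k hk), ← mul_sum]
  have hU : transmitters D.Q D.Tx S ⊆ S := filter_subset _ _
  -- Each transmitter is counted by the `t` members of `S` other than itself.
  have : ∑ k ∈ S, localFS D.Q D.Tx S k = #(transmitters D.Q D.Tx S) * t := by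
    have h2 : ∀ k ∈ S, localFS D.Q D.Tx S k + (if k ∈ transmitters D.Q D.Tx S then 1 else 0) =
        #(transmitters D.Q D.Tx S) := by
      intro k _
      unfold localFS
      split_ifs with h
      · exact card_erase_add_one h
      · rw [erase_eq_of_notMem h, add_zero]
    have h3 := sum_congr rfl h2
    rw [sum_add_distrib, sum_const, hS, ← sum_filter, filter_mem_eq_inter,
      inter_eq_right.2 hU, sum_const, smul_eq_mul, smul_eq_mul] at h3
    linarith
  rw [this]
  ring

lemma counter_lt (D : PTDesign K t) {S : Finset (Fin K)} {u j : Fin K}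
    (hu : u ∈ transmitters D.Q D.Tx S) (h : u ≠ j) :
    D.counter S u j < localFS D.Q D.Tx S j := by
  refine card_lt_card (Finset.ssubset_iff_subset_ne.2 ⟨filter_subset _ _, fun he => ?_⟩)
  have := he ▸ mem_erase.2 ⟨h, hu⟩
  simp at this

lemma counter_mul_add_lt (D : PTDesign K t) {S : Finset (Fin K)} {u j : Fin K} {i : ℕ}
    (hS : #S = t + 1) (hj : j ∈ S) (hu : u ∈ transmitters D.Q D.Tx S) (h : u ≠ j)
    (hi : i < D.z (setType D.Q S)) :
    D.counter S u j * D.z (setType D.Q S) + i < D.α (setType D.Q (S.erase j)) := by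
  rw [D.common S hS j hj]
  have := Nat.mul_le_mul_right (D.z (setType D.Q S)) (D.counter_lt hu h)
  rw [Nat.succ_mul] at this
  rw [mul_comm (D.z _)]
  omega

/-- The packets in a message, except for the one meant for user `k`, are cached by `k`. -/
lemma mem_cache_of_ne (D : PTDesign K t) {N : ℕ} (n : Fin N) {S : Finset (Fin K)}
    {u j k : Fin K} {i : ℕ} (hS : #S = t + 1) (hj : j ∈ S) (hu : u ∈ transmitters D.Q D.Tx S)
    (h : u ≠ j) (hi : i < D.z (setType D.Q S)) (hk : k ∈ S) (hkj : k ≠ j) :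
    ((n, ⟨S.erase j, D.counter S u j * D.z (setType D.Q S) + i⟩) :
      Fin N × ((_ : Finset (Fin K)) × ℕ)) ∈ (D.scheme N).cache k := by
  simp only [scheme, mem_product, mem_univ, true_and, mem_sigma, mem_filter, mem_powersetCard,
    subset_univ, mem_range, mem_erase]
  exact ⟨⟨by rw [card_erase_of_mem hj, hS]; rfl, hkj, hk⟩, D.counter_mul_add_lt hS hj hu h hi⟩

/-- Every rank below the cardinality is attained. -/
lemma exists_card_filter_lt_eq {V : Type*} [LinearOrder V] (A : Finset V) {c : ℕ} (hc : c < #A) :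
    ∃ u ∈ A, #(A.filter fun i => i < u) = c := by
  refine ⟨A.orderEmbOfFin rfl ⟨c, hc⟩, orderEmbOfFin_mem _ _ _, ?_⟩
  have : A.filter (fun i => i < A.orderEmbOfFin rfl ⟨c, hc⟩) =
      (univ.filter fun x : Fin #A => x < ⟨c, hc⟩).map (A.orderEmbOfFin rfl).toEmbedding := by
    ext x
    simp only [mem_filter, Finset.mem_map, mem_univ, true_and, RelEmbedding.coe_toEmbedding]
    constructor
    · rintro ⟨hx, hlt⟩
      have : x ∈ Set.range (A.orderEmbOfFin rfl) := by rw [range_orderEmbOfFin]; exact hx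
      obtain ⟨y, rfl⟩ := this
      exact ⟨y, (OrderEmbedding.lt_iff_lt _).1 hlt, rfl⟩
    · rintro ⟨y, hy, rfl⟩
      exact ⟨orderEmbOfFin_mem _ _ _, (OrderEmbedding.lt_iff_lt _).2 hy⟩
  rw [this, card_map, filter_gt_eq_Iio, Fin.card_Iio]

lemma sendable (D : PTDesign K t) (N : ℕ) (d : Fin K → Fin N) :
    ∀ μ ∈ (D.scheme N).msgs d,
      (D.scheme N).content d μ ⊆ (D.scheme N).cache ((D.scheme N).sender μ) := by
  rintro ⟨S, u, i⟩ hμ p hp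
  simp only [scheme, mem_sigma, mem_product, mem_powersetCard, subset_univ, true_and,
    mem_range] at hμ
  obtain ⟨j, hj, rfl⟩ := mem_image.1 hp
  have hj := mem_erase.1 hj
  exact D.mem_cache_of_ne _ hμ.1 hj.2 hμ.2.1 (Ne.symm hj.1) hμ.2.2
    (filter_subset _ _ hμ.2.1) (Ne.symm hj.1)

lemma value_eq_sum (D : PTDesign K t) {N b : ℕ}
    (W : Fin N → ((_ : Finset (Fin K)) × ℕ) → (Fin b → ZMod 2)) (d : Fin K → Fin N)
    (S : Finset (Fin K)) (u : Fin K) (i : ℕ) :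
    (D.scheme N).value W d ⟨S, u, i⟩ =
      ∑ j ∈ S.erase u, W (d j) ⟨S.erase j, D.counter S u j * D.z (setType D.Q S) + i⟩ := by
  unfold D2DScheme.value
  simp only [scheme]
  -- `S \ {j}` determines `j`, so no two packets of the XOR coincide, even if the demands do.
  rw [sum_image]
  intro j hj j' hj' h
  simp only [Prod.mk.injEq, Sigma.mk.injEq] at h
  exact (erase_inj S (mem_of_mem_erase hj)).1 h.2.1

/-- A missing packet `⟨T, i⟩` is served in `S = T ∪ {k}`. Division of `i` by the multiplier gives
the rank of its sender among the transmitters other than `k` as quotient, and the index of the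
message as remainder. All other packets of that message are cached by `k`. -/
lemma decodable (D : PTDesign K t) (N : ℕ) (d : Fin K → Fin N) (b : ℕ)
    (W W' : Fin N → ((_ : Finset (Fin K)) × ℕ) → (Fin b → ZMod 2)) (k : Fin K)
    (hc : ∀ p ∈ (D.scheme N).cache k, W p.1 p.2 = W' p.1 p.2)
    (hm : ∀ μ ∈ (D.scheme N).msgs d, (D.scheme N).value W d μ = (D.scheme N).value W' d μ) :
    ∀ p ∈ (D.scheme N).packets, W (d k) p = W' (d k) p := by
  rintro ⟨T, i⟩ hp
  simp only [scheme, mem_sigma, mem_powersetCard, subset_univ, true_and, mem_range] at hp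
  by_cases hk : k ∈ T
  · exact hc (d k, ⟨T, i⟩) (by simp [scheme, hp, hk])
  have hS : #(insert k T) = t + 1 := by rw [card_insert_of_notMem hk, hp.1]
  have hkS : k ∈ insert k T := mem_insert_self _ _
  have hT : (insert k T).erase k = T := erase_insert hk
  generalize insert k T = S at hS hkS hT
  have hα := D.common S hS k hkS
  rw [hT] at hα
  have hi : i < D.z (setType D.Q S) * localFS D.Q D.Tx S k := hα ▸ hp.2
  have hz : 0 < D.z (setType D.Q S) := Nat.pos_of_ne_zero fun h => by simp [h] at hi
  obtain ⟨u, hu, hrank⟩ := exists_card_filter_lt_eq ((transmitters D.Q D.Tx S).erase k)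
    (c := i / D.z (setType D.Q S)) (Nat.div_lt_of_lt_mul hi)
  have hcount : D.counter S u k = i / D.z (setType D.Q S) := hrank
  obtain ⟨huk, hu⟩ := mem_erase.1 hu
  have hr := Nat.mod_lt i hz
  have hmsg := hm ⟨S, u, i % D.z (setType D.Q S)⟩ (by simp [scheme, hS, hu, hr])
  rw [value_eq_sum, value_eq_sum, ← add_sum_erase _ _ (mem_erase.2 ⟨Ne.symm huk, hkS⟩),
    ← add_sum_erase _ _ (mem_erase.2 ⟨Ne.symm huk, hkS⟩), hT, hcount, Nat.div_add_mod'] at hmsg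
  rw [sum_congr rfl fun j hj => ?_] at hmsg
  · exact add_right_cancel hmsg
  · have hj1 := mem_erase.1 hj
    have hj2 := mem_erase.1 hj1.2
    exact hc _ (D.mem_cache_of_ne (d j) hS hj2.2 hu (Ne.symm hj2.1) hr hkS (Ne.symm hj1.1))

end PTDesign

/-! ## Symmetry and memory -/

/-- The users can be permuted transitively by permutations that respect the grouping. -/
def GroupingTransitive {K m : ℕ} (Q : Fin K → Fin m) : Prop :=
  ∀ k k' : Fin K, ∃ (σ : Equiv.Perm (Fin K)) (τ : Equiv.Perm (Fin m)),
    σ k = k' ∧ ∀ x, Q (σ x) = τ (Q x)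

/-- Such a permutation only reorders the list of group profiles, and types are unordered. -/
lemma setType_map_perm {K m : ℕ} {Q : Fin K → Fin m} {σ : Equiv.Perm (Fin K)}
    {τ : Equiv.Perm (Fin m)} (h : ∀ x, Q (σ x) = τ (Q x)) (B : Finset (Fin K)) :
    setType Q (B.map σ.toEmbedding) = setType Q B := by
  have hpart : ∀ (C : Finset (Fin K)) g,
      #(groupPart Q (C.map σ.toEmbedding) (τ g)) = #(groupPart Q C g) := by
    intro C g
    unfold groupPart
    rw [filter_map, card_map]
    congr 1
    ext x
    simp [h]
  have hprof : ∀ g, groupProfile Q (B.map σ.toEmbedding) (τ g) = groupProfile Q B g := by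
    intro g
    unfold groupProfile
    rw [hpart]
    have := hpart univ g
    rw [map_univ_equiv] at this
    rw [this]
  unfold setType
  have hmap : Multiset.map τ univ.val = univ.val := congrArg Finset.val (map_univ_equiv τ)
  conv_lhs => rw [← hmap, Multiset.map_map]
  exact Multiset.map_congr rfl fun g _ => hprof g

namespace PTDesign

variable {K t : ℕ}

/-- Each packet is cached by `t` users, which gives the sum of all cache sizes; transitivity makes
them equal. -/
lemma card_cache (D : PTDesign K t) (hD : GroupingTransitive D.Q) (N : ℕ) (k : Fin K) :
    K * #((D.scheme N).cache k) = N * (t * D.FPT) := by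
  set c : Fin K → ℕ := fun k =>
    ∑ T ∈ (powersetCard t univ).filter (fun T => k ∈ T), D.α (setType D.Q T) with hc
  have hcard : #((D.scheme N).cache k) = N * c k := by
    simp [scheme, card_product, card_sigma, hc]
  have hconst : ∀ k', c k' = c k := by
    intro k'
    obtain ⟨σ, τ, hσ, hτ⟩ := hD k' k
    refine sum_bij' (fun T _ => T.map σ.toEmbedding) (fun T _ => T.map σ.symm.toEmbedding)
      ?_ ?_ ?_ ?_ ?_
    · intro T hT
      simp only [mem_filter, mem_powersetCard, subset_univ, true_and, card_map] at hT ⊢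
      exact ⟨hT.1, Finset.mem_map.2 ⟨k', hT.2, hσ⟩⟩
    · intro T hT
      simp only [mem_filter, mem_powersetCard, subset_univ, true_and, card_map] at hT ⊢
      exact ⟨hT.1, Finset.mem_map.2 ⟨k, hT.2, by simp [← hσ]⟩⟩
    · intro T _
      ext x
      simp
    · intro T _
      ext x
      simp
    · intro T _
      rw [setType_map_perm hτ]
  have hsum : ∑ k', c k' = t * D.FPT := by
    simp only [hc, sum_filter]
    rw [sum_comm, FPT_eq_sum, mul_sum]
    refine sum_congr rfl fun T hT => ?_
    rw [← sum_filter, sum_const, filter_mem_eq_inter, univ_inter, (mem_powersetCard.1 hT).2,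
      smul_eq_mul]
  rw [sum_congr rfl (fun k' _ => hconst k'), sum_const, card_univ, Fintype.card_fin,
    smul_eq_mul] at hsum
  rw [hcard, ← hsum]
  ring

theorem scheme_achieves (D : PTDesign K t) (hD : GroupingTransitive D.Q) (ht : 0 < t)
    (htK : t ≤ K) {N : ℕ} {M : ℝ} (hN : 0 < N) (hM : (t : ℝ) = K * M / N) :
    (D.scheme N).Achieves M (N / M - 1) D.FPT := by
  have hK : (0 : ℝ) < K := by exact_mod_cast ht.trans_le htK
  have hN' : (0 : ℝ) < N := by exact_mod_cast hN
  have ht' : (0 : ℝ) < t := by exact_mod_cast ht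
  have hM' : M = t * N / K := by rw [hM]; field_simp
  refine ⟨D.FPT_pos, D.card_packets N, ?_, ?_, D.sendable N, D.decodable N, ?_⟩
  · intro k
    refine product_subset_product_right ?_
    exact sigma_mono (filter_subset _ _) fun _ => subset_rfl
  · intro k
    have h : (K : ℝ) * #((D.scheme N).cache k) = N * (t * D.FPT) := by
      exact_mod_cast D.card_cache hD N k
    refine le_of_eq ?_
    rw [hM']
    field_simp
    linarith
  · intro d
    have h : (t : ℝ) * #((D.scheme N).msgs d) = (K - t) * D.FPT := by
      rw [← Nat.cast_sub htK]
      exact_mod_cast D.card_msgs N d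
    have : (N : ℝ) / M = K / t := by rw [hM']; field_simp
    rw [this]
    field_simp
    linarith

end PTDesign

/-! ## Groupings into pairs -/

section Pairing

variable {K m t : ℕ}

/-- The groups that contain exactly `i` users of `B`. -/
def groupsWith (Q : Fin K → Fin m) (B : Finset (Fin K)) (i : ℕ) : Finset (Fin m) :=
  univ.filter fun g => #(groupPart Q B g) = i

lemma mem_groupsWith {Q : Fin K → Fin m} {B : Finset (Fin K)} {i : ℕ} {g : Fin m} :
    g ∈ groupsWith Q B i ↔ #(groupPart Q B g) = i := by
  simp [groupsWith]

lemma sum_card_groupPart (Q : Fin K → Fin m) (B : Finset (Fin K)) :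
    ∑ g, #(groupPart Q B g) = #B :=
  (card_eq_sum_card_fiberwise fun _ _ => mem_univ _).symm

lemma groupPart_erase (Q : Fin K → Fin m) (B : Finset (Fin K)) (k : Fin K) (g : Fin m) :
    groupPart Q (B.erase k) g = (groupPart Q B g).erase k := by
  unfold groupPart
  exact filter_erase _ _ _

lemma card_groupPart_erase_of_ne (Q : Fin K → Fin m) (B : Finset (Fin K)) {k : Fin K} {g : Fin m}
    (h : Q k ≠ g) : #(groupPart Q (B.erase k) g) = #(groupPart Q B g) := by
  rw [groupPart_erase, erase_eq_of_notMem]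
  simp [groupPart, h]

lemma card_groupPart_erase (Q : Fin K → Fin m) {B : Finset (Fin K)} {k : Fin K} (hk : k ∈ B) :
    #(groupPart Q (B.erase k) (Q k)) + 1 = #(groupPart Q B (Q k)) := by
  rw [groupPart_erase, card_erase_add_one]
  simp [groupPart, hk]

lemma groupsWith_one_erase_of_one {Q : Fin K → Fin m} {B : Finset (Fin K)} {k : Fin K}
    (hk : k ∈ B) (h : #(groupPart Q B (Q k)) = 1) :
    #(groupsWith Q (B.erase k) 1) + 1 = #(groupsWith Q B 1) := by
  have h1 := card_groupPart_erase Q hk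
  have : groupsWith Q (B.erase k) 1 = (groupsWith Q B 1).erase (Q k) := by
    ext g
    rw [mem_erase, mem_groupsWith, mem_groupsWith]
    rcases eq_or_ne (Q k) g with rfl | hg
    · constructor
      · omega
      · exact fun h => absurd rfl h.1
    · rw [card_groupPart_erase_of_ne Q B hg]
      exact ⟨fun h => ⟨Ne.symm hg, h⟩, fun h => h.2⟩
  rw [this, card_erase_add_one (mem_groupsWith.2 h)]

lemma groupsWith_one_erase_of_two {Q : Fin K → Fin m} {B : Finset (Fin K)} {k : Fin K}
    (hk : k ∈ B) (h : #(groupPart Q B (Q k)) = 2) :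
    #(groupsWith Q (B.erase k) 1) = #(groupsWith Q B 1) + 1 := by
  have h1 := card_groupPart_erase Q hk
  have : groupsWith Q (B.erase k) 1 = insert (Q k) (groupsWith Q B 1) := by
    ext g
    rw [mem_insert, mem_groupsWith, mem_groupsWith]
    rcases eq_or_ne (Q k) g with rfl | hg
    · constructor
      · exact fun _ => Or.inl rfl
      · omega
    · rw [card_groupPart_erase_of_ne Q B hg]
      exact ⟨Or.inr, fun h => h.resolve_left (Ne.symm hg)⟩
  rw [this, card_insert_of_notMem]
  rw [mem_groupsWith]
  omega

variable {Q : Fin K → Fin m} (hQ : ∀ g, #(groupPart Q univ g) = 2)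

include hQ

lemma card_groupPart_le_two (B : Finset (Fin K)) (g : Fin m) : #(groupPart Q B g) ≤ 2 :=
  (card_le_card (filter_subset_filter _ (subset_univ B))).trans (hQ g).le

lemma groups_of_two : 2 * m = K := by
  have h := sum_card_groupPart Q univ
  rw [sum_congr rfl fun g _ => hQ g] at h
  simpa [mul_comm] using h

lemma card_eq_groupsWith (B : Finset (Fin K)) :
    #B = #(groupsWith Q B 1) + 2 * #(groupsWith Q B 2) := by
  rw [← sum_card_groupPart Q B, groupsWith, groupsWith, card_filter, card_filter, mul_sum,
    ← sum_add_distrib]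
  refine sum_congr rfl fun g _ => ?_
  have := card_groupPart_le_two hQ B g
  interval_cases #(groupPart Q B g) <;> rfl

lemma groupsWith_add (B : Finset (Fin K)) :
    #(groupsWith Q B 0) + #(groupsWith Q B 1) + #(groupsWith Q B 2) = m := by
  rw [groupsWith, groupsWith, groupsWith, card_filter, card_filter, card_filter,
    ← sum_add_distrib, ← sum_add_distrib]
  rw [sum_congr rfl (g := fun _ => 1)]
  · simp
  · intro g _
    have := card_groupPart_le_two hQ B g
    interval_cases #(groupPart Q B g) <;> rfl

lemma groupProfile_eq (B : Finset (Fin K)) (g : Fin m) :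
    groupProfile Q B g = (2, #(groupPart Q B g)) := by
  rw [groupProfile, hQ]

lemma count_setType (B : Finset (Fin K)) :
    (setType Q B).count (2, 1) = #(groupsWith Q B 1) := by
  rw [setType, Multiset.count_map, groupsWith, card_def, filter_val]
  congr 1
  refine Multiset.filter_congr fun g _ => ?_
  rw [groupProfile_eq hQ, Prod.mk.injEq]
  exact ⟨fun h => h.2.symm, fun h => ⟨rfl, h.symm⟩⟩

/-- Identifies the one type of labels that meet every pair, the reference type to which all
splitting factors are compared. -/
lemma setType_eq_of_groupsWith_zero {B : Finset (Fin K)} (h : #(groupsWith Q B 0) = 0) :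
    setType Q B = Multiset.replicate #(groupsWith Q B 1) (2, 1) +
      Multiset.replicate #(groupsWith Q B 2) (2, 2) := by
  have h2 : (univ.filter fun g => ¬ #(groupPart Q B g) = 1) = groupsWith Q B 2 := by
    rw [groupsWith]
    refine filter_congr fun g _ => ?_
    have h0 : #(groupPart Q B g) ≠ 0 := fun hg => by
      rw [card_eq_zero] at h
      simpa [h] using mem_groupsWith.2 hg
    have := card_groupPart_le_two hQ B g
    omega
  have hval : (univ : Finset (Fin m)).val = (groupsWith Q B 1).val + (groupsWith Q B 2).val := by
    rw [← h2, groupsWith, filter_val, filter_val, Multiset.filter_add_not]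
  rw [setType, hval, Multiset.map_add]
  have hi : ∀ i, (groupsWith Q B i).val.map (groupProfile Q B) =
      Multiset.replicate #(groupsWith Q B i) (2, i) := by
    intro i
    rw [Multiset.map_congr rfl (g := fun _ => (2, i)), Multiset.map_const']
    · rfl
    · intro g hg
      rw [groupProfile_eq hQ, mem_groupsWith.1 (mem_def.2 hg)]
  rw [hi, hi]

/-! ### Splitting factors when only users without their partner transmit -/

lemma transmitters_single (S : Finset (Fin K)) :
    transmitters Q (fun _ => {(2, 1)}) S = S.filter fun k => #(groupPart Q S (Q k)) = 1 := by
  unfold transmitters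
  refine filter_congr fun k _ => ?_
  rw [groupProfile_eq hQ]
  simp

lemma card_transmitters_single (S : Finset (Fin K)) :
    #(transmitters Q (fun _ => {(2, 1)}) S) = #(groupsWith Q S 1) := by
  rw [transmitters_single hQ, card_eq_sum_card_fiberwise (f := Q) (t := groupsWith Q S 1),
    sum_congr rfl (g := fun _ => 1)]
  · simp
  · intro g hg
    rw [mem_groupsWith] at hg
    rw [filter_filter]
    refine Eq.trans ?_ hg
    refine congrArg card (filter_congr fun k _ => ?_)
    constructor
    · exact fun h => h.2
    · rintro rfl
      exact ⟨hg, rfl⟩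
  · intro k hk
    exact mem_coe.2 (mem_groupsWith.2 (mem_filter.1 hk).2)

lemma localFS_single_of_one {S : Finset (Fin K)} {k : Fin K} (hk : k ∈ S)
    (h : #(groupPart Q S (Q k)) = 1) :
    localFS Q (fun _ => {(2, 1)}) S k = #(groupsWith Q S 1) - 1 := by
  rw [localFS, card_erase_of_mem, card_transmitters_single hQ]
  rw [transmitters_single hQ]
  exact mem_filter.2 ⟨hk, h⟩

lemma localFS_single_of_two {S : Finset (Fin K)} {k : Fin K}
    (h : #(groupPart Q S (Q k)) = 2) :
    localFS Q (fun _ => {(2, 1)}) S k = #(groupsWith Q S 1) := by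
  rw [localFS, erase_eq_of_notMem, card_transmitters_single hQ]
  rw [transmitters_single hQ]
  intro hk
  have := (mem_filter.1 hk).2
  omega

lemma one_or_two_of_mem {S : Finset (Fin K)} {k : Fin K} (hk : k ∈ S) :
    #(groupPart Q S (Q k)) = 1 ∨ #(groupPart Q S (Q k)) = 2 := by
  have h1 := card_groupPart_erase Q hk
  have h2 := card_groupPart_le_two hQ S (Q k)
  omega

/-- The splitting factors of the subfile labels with `2 * j` singly represented pairs may be taken
as `a j` for every sequence satisfying the two-term relations. -/
lemma isCommonMultiple_single {n : ℕ} (hK : t + 2 * n = K) {a z : ℕ → ℕ}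
    (h1 : ∀ j < n, a j = z j * (2 * j)) (h2 : ∀ j < n, a (j + 1) = z j * (2 * j + 1)) :
    IsCommonMultiple Q t (fun _ => {(2, 1)})
      (fun v => a (v.count (2, 1) / 2)) (fun s => z (s.count (2, 1) / 2)) := by
  intro S hS k hk
  simp only [count_setType hQ]
  have e1 := card_eq_groupsWith hQ S
  have e2 := groupsWith_add hQ S
  have e3 := groups_of_two hQ
  -- `K` and hence `t` are even, so `S` has odd size and contains an odd number of single users.
  obtain ⟨j, hj⟩ : ∃ j, #(groupsWith Q S 1) = 2 * j + 1 :=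
    ⟨#(groupsWith Q S 1) / 2, by omega⟩
  have hjn : j < n := by omega
  have hj' : (2 * j + 1) / 2 = j := by omega
  rcases one_or_two_of_mem hQ hk with h | h
  · have h3 := groupsWith_one_erase_of_one hk h
    have h4 : #(groupsWith Q (S.erase k) 1) / 2 = j := by omega
    rw [localFS_single_of_one hQ hk h, h4, hj, hj', h1 j hjn]
    rfl
  · have h3 := groupsWith_one_erase_of_two hk h
    have h4 : #(groupsWith Q (S.erase k) 1) / 2 = j + 1 := by omega
    rw [localFS_single_of_two hQ h, h4, hj, hj', h2 j hjn]

/-- From a label whose complement contains a whole pair one reaches a label with two more singly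
represented pairs through a common multicast group. -/
lemma exists_label_two_more {b : ℕ} (hK : t + b = K) (hb : b ≤ m) {T : Finset (Fin K)}
    (hT : #T = t) (hlt : #(groupsWith Q T 1) < b) :
    ∃ T' : Finset (Fin K), #T' = t ∧ #(groupsWith Q T' 1) = #(groupsWith Q T 1) + 2 ∧
      ∀ α z, IsCommonMultiple Q t (fun _ => {(2, 1)}) α z →
        α (setType Q T) * (#(groupsWith Q T 1) + 1) =
          α (setType Q T') * #(groupsWith Q T 1) := by
  have e1 := card_eq_groupsWith hQ T
  have e2 := groupsWith_add hQ T
  have e3 := groups_of_two hQ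
  -- The complement has `b` users, more than the single ones account for, so a pair is missed. Since
  -- `b ≤ m`, at least as many pairs are contained in `T` as are missed.
  obtain ⟨g, hg⟩ := card_pos.1 (by omega : 0 < #(groupsWith Q T 0))
  obtain ⟨g', hg'⟩ := card_pos.1 (by omega : 0 < #(groupsWith Q T 2))
  rw [mem_groupsWith] at hg hg'
  obtain ⟨k, hk⟩ := card_pos.1 (by rw [hQ]; omega : 0 < #(groupPart Q univ g))
  obtain ⟨k', hk'⟩ := card_pos.1 (by omega : 0 < #(groupPart Q T g'))
  obtain rfl : Q k = g := (mem_filter.1 hk).2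
  obtain ⟨hkT', rfl⟩ := mem_filter.1 hk'
  have hkT : k ∉ T := fun h => by
    have : k ∈ groupPart Q T (Q k) := mem_filter.2 ⟨h, rfl⟩
    rw [card_eq_zero.1 hg] at this
    simp at this
  have hne : Q k ≠ Q k' := fun h => by rw [h] at hg; omega
  have hS : #(insert k T) = t + 1 := by rw [card_insert_of_notMem hkT, hT]
  have hkS : k ∈ insert k T := mem_insert_self _ _
  have hkS' : k' ∈ insert k T := mem_insert_of_mem hkT'
  have hST : (insert k T).erase k = T := erase_insert hkT
  -- In this multicast group `k` is single and `k'` is paired; removing `k` gives back `T`, removing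
  -- `k'` gives `T'`.
  generalize insert k T = S at hS hkS hkS' hST
  have n1 : #(groupPart Q S (Q k)) = 1 := by
    have := card_groupPart_erase Q hkS
    rw [hST] at this
    omega
  have n2 : #(groupPart Q S (Q k')) = 2 := by
    rw [← card_groupPart_erase_of_ne Q S hne, hST, hg']
  have s1 := groupsWith_one_erase_of_one hkS n1
  have s2 := groupsWith_one_erase_of_two hkS' n2
  rw [hST] at s1
  refine ⟨S.erase k', by rw [card_erase_of_mem hkS', hS]; rfl, by omega, fun α z h => ?_⟩
  have c1 := h S hS k hkS
  have c2 := h S hS k' hkS'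
  rw [localFS_single_of_one hQ hkS n1, ← s1, hST, Nat.add_sub_cancel] at c1
  rw [localFS_single_of_two hQ n2, ← s1] at c2
  rw [c1, c2]
  ring

/-- All common multiples have the same ratios to the factor of the labels whose complements meet
every pair at most once. -/
lemma exists_ratio {n : ℕ} (hK : t + 2 * n = K) (hb : 2 * n ≤ m) {T : Finset (Fin K)}
    (hT : #T = t) :
    Multiset.replicate (2 * n) (2, 1) + Multiset.replicate (m - 2 * n) (2, 2) ∈
        subfileTypes Q t ∧
      ∃ p q : ℕ, 0 < q ∧ ∀ α z, IsCommonMultiple Q t (fun _ => {(2, 1)}) α z →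
        α (setType Q T) * q = α (Multiset.replicate (2 * n) (2, 1) +
          Multiset.replicate (m - 2 * n) (2, 2)) * p := by
  induction h : n - #(groupsWith Q T 1) / 2 generalizing T with
  | zero =>
    have e1 := card_eq_groupsWith hQ T
    have e2 := groupsWith_add hQ T
    have e3 := groups_of_two hQ
    have h1 : #(groupsWith Q T 1) = 2 * n := by omega
    have h2 : #(groupsWith Q T 2) = m - 2 * n := by omega
    have h3 := setType_eq_of_groupsWith_zero hQ (B := T) (by omega)
    rw [h1, h2] at h3
    rw [← h3]
    exact ⟨mem_image_of_mem _ (mem_powersetCard.2 ⟨subset_univ _, hT⟩), 1, 1, one_pos,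
      fun α z _ => rfl⟩
  | succ i ih =>
    obtain ⟨T', hT', hc, hr⟩ := exists_label_two_more hQ hK hb hT (by omega)
    obtain ⟨hv, p, q, hq, hpq⟩ := ih hT' (by omega)
    -- The denominator stays positive, whereas the numerator vanishes for labels without single
    -- users: these are excluded.
    refine ⟨hv, p * #(groupsWith Q T 1), q * (#(groupsWith Q T 1) + 1), by positivity,
      fun α z hα => ?_⟩
    have a1 := hr α z hα
    have a2 := hpq α z hα
    calc _ = α (setType Q T) * (#(groupsWith Q T 1) + 1) * q := by ring
      _ = α (setType Q T') * q * #(groupsWith Q T 1) := by rw [a1]; ring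
      _ = _ := by rw [a2]; ring

end Pairing

/-- A solution of the two-term relations that ends in a product of odd numbers. -/
lemma exists_splitting_sequence (n : ℕ) :
    ∃ a z : ℕ → ℕ, (∀ j < n, a j = z j * (2 * j)) ∧ (∀ j < n, a (j + 1) = z j * (2 * j + 1)) ∧
      a n = ∏ i ∈ range n, (2 * i + 1) := by
  induction n with
  | zero => exact ⟨fun _ => 1, fun _ => 1, by simp, by simp, by simp⟩
  | succ n ih =>
    obtain ⟨a, z, h1, h2, h3⟩ := ih
    -- Scaling the old solution by `2n` makes its last entry divisible by `2n`, with the product of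
    -- the first `n` odd numbers as the new multiplier. For `n = 0` the scaling by zero gives the
    -- forced value `a 0 = 0`.
    refine ⟨fun j => if j ≤ n then a j * (2 * n) else ∏ i ∈ range (n + 1), (2 * i + 1),
      fun j => if j < n then z j * (2 * n) else ∏ i ∈ range n, (2 * i + 1), ?_, ?_, ?_⟩
    · intro j hj
      rcases (Nat.lt_succ_iff.1 hj).lt_or_eq with h | rfl
      · simp only [h, h.le, if_true, h1 j h]
        ring
      · simp [h3]
    · intro j hj
      rcases (Nat.lt_succ_iff.1 hj).lt_or_eq with h | rfl
      · simp only [h, Nat.succ_le_of_lt h, if_true, h2 j h]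
        ring
      · simp [prod_range_succ]
    · simp

/-! ## The order of growth -/

/-- Each factor is below `2n ≤ 2 ^ (2n)`. The bound is crude, but its exponent is `tbar ^ 2` for
`tbar = 2n`, which suffices. -/
lemma prod_odd_le_two_pow (n : ℕ) :
    ∏ i ∈ Finset.Icc 1 n, (2 * (i : ℝ) - 1) ≤ 2 ^ ((2 * n) ^ 2) := by
  have h : ∀ i ∈ Finset.Icc 1 n, (2 * (i : ℝ) - 1) ≤ 2 ^ (2 * n) := by
    intro i hi
    have hi := Finset.mem_Icc.1 hi
    have h1 : (i : ℝ) ≤ n := by exact_mod_cast hi.2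
    have h2 : ((2 * n : ℕ) : ℝ) ≤ 2 ^ (2 * n) := by exact_mod_cast Nat.lt_two_pow_self.le
    push_cast at h2
    linarith
  refine (prod_le_prod (fun i hi => ?_) h).trans ?_
  · have : (1 : ℝ) ≤ i := by exact_mod_cast (Finset.mem_Icc.1 hi).1
    linarith
  · rw [prod_const, Nat.card_Icc, ← pow_mul]
    refine pow_le_pow_right₀ one_le_two ?_
    have : 2 * n * (n + 1 - 1) = 2 * n ^ 2 := by rw [Nat.add_sub_cancel]; ring
    rw [this]
    nlinarith

/-- As `(log x)² = o(x)` with `x = log K`, the exponent `b²` is eventually at most half of `log₂ K`,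
and the quotient is at most `K ^ (-1/2)`. -/
lemma tendsto_two_pow_sq_div {K b : ℕ → ℕ} (hK : Tendsto K atTop atTop)
    (hb : (fun n => (b n : ℝ)) =O[atTop] fun n => Real.logb 2 (Real.logb 2 (K n : ℝ))) :
    Tendsto (fun n => (2 : ℝ) ^ (b n ^ 2) / K n) atTop (𝓝 0) := by
  set L : ℕ → ℝ := fun n => Real.logb 2 (K n) with hL
  have hKr : Tendsto (fun n => (K n : ℝ)) atTop atTop := tendsto_natCast_atTop_atTop.comp hK
  have hLt : Tendsto L atTop atTop := (Real.tendsto_logb_atTop one_lt_two).comp hKr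
  have hsq : (fun x : ℝ => Real.logb 2 x ^ 2) =o[atTop] fun x => x := by
    have h := Real.isLittleO_pow_log_id_atTop (n := 2)
    have he : (fun x : ℝ => Real.logb 2 x ^ 2) =
        fun x => (Real.log 2 ^ 2)⁻¹ * Real.log x ^ 2 := by
      funext x
      rw [Real.logb, div_pow, div_eq_inv_mul]
    rw [he]
    exact h.const_mul_left _
  have hbo : (fun n => (b n : ℝ) ^ 2) =o[atTop] L :=
    (hb.pow 2).trans_isLittleO (hsq.comp_tendsto hLt)
  have hev : ∀ᶠ n in atTop, (b n : ℝ) ^ 2 ≤ L n / 2 := by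
    filter_upwards [hbo.bound (show (0 : ℝ) < 1 / 2 by norm_num), hLt.eventually_ge_atTop 0]
      with n hn h0
    rw [Real.norm_of_nonneg (by positivity), Real.norm_of_nonneg h0] at hn
    linarith
  have hlim : Tendsto (fun n => (2 : ℝ) ^ (-(L n / 2))) atTop (𝓝 0) := by
    have h1 : Tendsto (fun n => -(L n / 2)) atTop atBot :=
      tendsto_neg_atTop_atBot.comp (hLt.atTop_div_const two_pos)
    exact (tendsto_rpow_atBot_of_base_gt_one 2 one_lt_two).comp h1
  refine squeeze_zero' (Eventually.of_forall fun n => by positivity) ?_ hlim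
  filter_upwards [hev, hKr.eventually_gt_atTop 0] with n hn h0
  have h1 : (K n : ℝ) = 2 ^ L n := (Real.rpow_logb two_pos (by norm_num) h0).symm
  rw [h1, ← Real.rpow_natCast, ← Real.rpow_sub two_pos]
  refine Real.rpow_le_rpow_of_exponent_le one_le_two ?_
  push_cast
  linarith

lemma tendsto_ratio_of_le {K t b : ℕ → ℕ} {F : ℕ → ℝ} (hA : ∀ n, Admissible (K n) (t n) (b n))
    (hK : Tendsto K atTop atTop)
    (hO : (fun n => 1 - (t n : ℝ) / K n) =O[atTop]
      fun n => Real.logb 2 (Real.logb 2 (K n : ℝ)) / K n)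
    (hF0 : ∀ n, 0 ≤ F n)
    (hF : ∀ n, F n ≤ 1 / (t n : ℝ) * ∏ i ∈ Finset.Icc 1 (b n / 2), (2 * (i : ℝ) - 1)) :
    Tendsto F atTop (𝓝 0) := by
  have hKpos : ∀ n, (0 : ℝ) < K n := fun n => by
    have := (hA n).2.2.2.1
    exact_mod_cast (by omega : 0 < K n)
  have hb : (fun n => (b n : ℝ)) =O[atTop] fun n => Real.logb 2 (Real.logb 2 (K n : ℝ)) := by
    have h := hO.mul (isBigO_refl (fun n => (K n : ℝ)) atTop)
    refine (h.congr (fun n => ?_) fun n => ?_)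
    · have h1 : ((t n + b n : ℕ) : ℝ) = K n := by rw [(hA n).1]
      push_cast at h1
      have := hKpos n
      field_simp
      linarith
    · have := hKpos n
      field_simp
  have h2 := (tendsto_two_pow_sq_div hK hb).const_mul 2
  rw [mul_zero] at h2
  refine squeeze_zero hF0 (fun n => (hF n).trans ?_) h2
  obtain ⟨h1, _, hev, h4, h5⟩ := hA n
  have ht : (K n : ℝ) ≤ 2 * t n := by exact_mod_cast (by omega : K n ≤ 2 * t n)
  have hp := prod_odd_le_two_pow (b n / 2)
  rw [Nat.two_mul_div_two_of_even hev] at hp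
  have hK0 := hKpos n
  have ht0 : (0 : ℝ) < t n := by linarith
  calc _ ≤ 1 / (t n : ℝ) * 2 ^ (b n ^ 2) := by gcongr
    _ ≤ 2 / K n * 2 ^ (b n ^ 2) := by
      gcongr ?_ * _
      rw [div_le_div_iff₀ ht0 hK0]
      linarith
    _ = _ := by ring

/-! ## The designs -/

section Designs

variable {K m t : ℕ}

/-- If all common multiples are determined by their value at one type, then there is a least one
with given zero entries. -/
lemma IsCommonMultiple.exists_least {Q : Fin K → Fin m}
    {Tx : Multiset (ℕ × ℕ) → Finset (ℕ × ℕ)} {α₀ z₀ : Multiset (ℕ × ℕ) → ℕ}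
    (h₀ : IsCommonMultiple Q t Tx α₀ z₀) {v₀ : Multiset (ℕ × ℕ)} (hv₀ : v₀ ∈ subfileTypes Q t)
    (hne : α₀ v₀ ≠ 0)
    (hratio : ∀ v ∈ subfileTypes Q t, ∃ p q : ℕ, 0 < q ∧
      ∀ α z, IsCommonMultiple Q t Tx α z → α v * q = α v₀ * p) :
    ∃ α z, IsCommonMultiple Q t Tx α z ∧ α v₀ ≠ 0 ∧
      (∀ β w : Multiset (ℕ × ℕ) → ℕ, IsCommonMultiple Q t Tx β w →
        (∀ v ∈ subfileTypes Q t, β v = 0 ↔ α v = 0) → ∀ v ∈ subfileTypes Q t, α v ≤ β v) ∧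
      ∀ v ∈ subfileTypes Q t, α v ≤ α₀ v := by
  classical
  -- Among the common multiples with the zero entries of `α₀`, take one with the smallest value at
  -- `v₀`; proportionality makes it least at all other types too.
  have hex : ∃ c, ∃ α z, (IsCommonMultiple Q t Tx α z ∧
      ∀ v ∈ subfileTypes Q t, α v = 0 ↔ α₀ v = 0) ∧ α v₀ = c :=
    ⟨_, α₀, z₀, ⟨h₀, fun _ _ => Iff.rfl⟩, rfl⟩
  obtain ⟨α, z, ⟨hα, hz⟩, hc⟩ := Nat.find_spec hex
  have key : ∀ β w : Multiset (ℕ × ℕ) → ℕ, IsCommonMultiple Q t Tx β w →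
      (∀ v ∈ subfileTypes Q t, β v = 0 ↔ α₀ v = 0) → ∀ v ∈ subfileTypes Q t, α v ≤ β v := by
    intro β w hβ hβz v hv
    have hle : α v₀ ≤ β v₀ := hc ▸ Nat.find_min' hex ⟨β, w, ⟨hβ, hβz⟩, rfl⟩
    have hpos : 0 < β v₀ := Nat.pos_of_ne_zero fun h => hne ((hβz v₀ hv₀).1 h)
    obtain ⟨p, q, hq, hpq⟩ := hratio v hv
    have h1 := hpq α z hα
    have h2 := hpq β w hβ
    refine Nat.le_of_mul_le_mul_right ?_ (Nat.mul_pos hq hpos)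
    calc α v * (q * β v₀) = α v * q * β v₀ := by ring
      _ = β v * q * α v₀ := by rw [h1, h2]; ring
      _ ≤ β v * q * β v₀ := Nat.mul_le_mul_left _ hle
      _ = _ := by ring
  exact ⟨α, z, hα, fun h => hne ((hz v₀ hv₀).1 h),
    fun β w hβ hβz => key β w hβ fun v hv => (hβz v hv).trans (hz v hv),
    key α₀ z₀ h₀ fun _ _ => Iff.rfl⟩

lemma FPT_le_of_α_le {D : PTDesign K t} {c : ℕ} (h : ∀ v ∈ subfileTypes D.Q t, D.α v ≤ c) :
    D.FPT ≤ c * K.choose t := by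
  rw [D.FPT_eq_sum]
  refine (sum_le_sum fun T hT => h _ (mem_image_of_mem _ hT)).trans ?_
  rw [sum_const, card_powersetCard, card_univ, Fintype.card_fin, smul_eq_mul, mul_comm]

lemma surjective_of_groups_of_two {Q : Fin K → Fin m} (hQ : ∀ g, #(groupPart Q univ g) = 2) :
    Function.Surjective Q := fun g => by
  obtain ⟨k, hk⟩ := card_pos.1 (by rw [hQ]; omega : 0 < #(groupPart Q univ g))
  exact ⟨k, (mem_filter.1 hk).2⟩

lemma transmitters_all (Q : Fin K → Fin m) (S : Finset (Fin K)) :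
    transmitters Q (fun s => s.toFinset) S = S := by
  refine filter_true_of_mem fun k _ => ?_
  rw [Multiset.mem_toFinset]
  exact Multiset.mem_map_of_mem _ (mem_univ (Q k))

/-- The design in which all users of a multicast group transmit, as in the scheme of Ji, Caire
and Molisch. -/
lemma exists_design_all {Q : Fin K → Fin m} (hQ : ∀ g, #(groupPart Q univ g) = 2)
    (htr : GroupingTransitive Q) {c : ℕ} (ht : t ≤ K) (hc : 0 < c) (hct : t < K → c = t)
    (hct1 : t = K → c = 1) :
    ∃ D : PTDesign K t, D.IsPairing ∧ GroupingTransitive D.Q ∧ D.FPT ≤ c * K.choose t := by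
  have hfs : ∀ S : Finset (Fin K), #S = t + 1 → ∀ k ∈ S,
      localFS Q (fun s => s.toFinset) S k = t := by
    intro S hS k hk
    rw [localFS, transmitters_all, card_erase_of_mem hk, hS]
    rfl
  have hlt : ∀ S : Finset (Fin K), #S = t + 1 → t < K := fun S hS => by
    have := card_le_univ S
    rw [Fintype.card_fin] at this
    omega
  obtain ⟨T, hT⟩ : (powersetCard t (univ : Finset (Fin K))).Nonempty :=
    powersetCard_nonempty.2 (by simpa using ht)
  -- If `t = K` there are no multicast groups, the common multiple condition is void, and the least
  -- nonzero factor is `1` instead of `t`.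
  refine ⟨⟨m, Q, surjective_of_groups_of_two hQ, fun s => s.toFinset, fun _ => c, fun _ => 1,
    ?_, ?_, ?_⟩, hQ, htr, FPT_le_of_α_le fun _ _ => le_rfl⟩
  · intro S hS k hk
    rw [hfs S hS k hk, one_mul, hct (hlt S hS)]
  · exact ⟨_, mem_image_of_mem _ hT, hc.ne'⟩
  · intro β w hβ hz v hv
    have hne : β v ≠ 0 := fun h => hc.ne' ((hz v hv).1 h)
    obtain ⟨T, hT, rfl⟩ := mem_image.1 hv
    have hT := (mem_powersetCard.1 hT).2
    rcases ht.lt_or_eq with h | h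
    · obtain ⟨k, hk⟩ := card_pos.1 (by rw [card_compl, hT, Fintype.card_fin]; omega : 0 < #Tᶜ)
      rw [mem_compl] at hk
      have hS : #(insert k T) = t + 1 := by rw [card_insert_of_notMem hk, hT]
      have hβk := hβ _ hS k (mem_insert_self _ _)
      rw [hfs _ hS k (mem_insert_self _ _), erase_insert hk] at hβk
      rw [hβk] at hne ⊢
      rw [hct h]
      exact Nat.le_mul_of_pos_left _ (Nat.pos_of_ne_zero (left_ne_zero_of_mul hne))
    · rw [hct1 h]
      exact Nat.one_le_iff_ne_zero.2 hne

/-- The design in which exactly the users without their partner transmit. -/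
lemma exists_design_single {Q : Fin K → Fin m} (hQ : ∀ g, #(groupPart Q univ g) = 2)
    (htr : GroupingTransitive Q) {n : ℕ} (hK : t + 2 * n = K) (hn : 2 * n ≤ m) :
    ∃ D : PTDesign K t, D.IsPairing ∧ GroupingTransitive D.Q ∧
      D.FPT ≤ (∏ i ∈ range n, (2 * i + 1)) * K.choose t := by
  obtain ⟨a, z, h1, h2, h3⟩ := exists_splitting_sequence n
  -- Consecutive entries are `z j * 2j` and `z j * (2j+1)`.
  have hmono : ∀ j ≤ n, a j ≤ a n := by
    intro j hj
    refine Nat.decreasingInduction' (P := fun j => a j ≤ a n) (fun i hi _ h => ?_) hj le_rfl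
    rw [h2 i hi] at h
    rw [h1 i hi]
    exact (Nat.mul_le_mul_left _ (Nat.le_succ _)).trans h
  have hpos : a n ≠ 0 := by
    rw [h3]
    exact prod_ne_zero_iff.2 fun i _ => Nat.succ_ne_zero _
  obtain ⟨T₀, hT₀⟩ : (powersetCard t (univ : Finset (Fin K))).Nonempty :=
    powersetCard_nonempty.2 (by simp; omega)
  have hv₀ := (exists_ratio hQ hK hn (mem_powersetCard.1 hT₀).2).1
  obtain ⟨α, w, hα, hne, hl, hle⟩ := (isCommonMultiple_single hQ hK h1 h2).exists_least hv₀
    (by simpa [Multiset.count_replicate] using hpos) fun v hv => by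
      obtain ⟨T, hT, rfl⟩ := mem_image.1 hv
      exact (exists_ratio hQ hK hn (mem_powersetCard.1 hT).2).2
  refine ⟨⟨m, Q, surjective_of_groups_of_two hQ, fun _ => {(2, 1)}, α, w, hα, ⟨_, hv₀, hne⟩, hl⟩,
    hQ, htr, FPT_le_of_α_le fun v hv => (hle v hv).trans ?_⟩
  rw [← h3]
  obtain ⟨T, hT, rfl⟩ := mem_image.1 hv
  have hT := (mem_powersetCard.1 hT).2
  rw [count_setType hQ]
  have e1 := card_eq_groupsWith hQ T
  have e2 := groupsWith_add hQ T
  have e3 := groups_of_two hQ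
  exact hmono _ (by omega)

/-- The users can be grouped into pairs in a symmetric way. -/
lemma exists_pairing (m : ℕ) : ∃ Q : Fin (m * 2) → Fin m,
    (∀ g, #(groupPart Q univ g) = 2) ∧ GroupingTransitive Q := by
  refine ⟨fun k => (finProdFinEquiv.symm k).1, fun g => ?_, fun k k' => ?_⟩
  · have : groupPart (fun k : Fin (m * 2) => (finProdFinEquiv.symm k).1) univ g =
        (({g} : Finset (Fin m)) ×ˢ (univ : Finset (Fin 2))).map finProdFinEquiv.toEmbedding := by
      ext k
      rw [mem_map_equiv, mem_product, mem_singleton]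
      simp only [groupPart, mem_filter, mem_univ, true_and, and_true]
    rw [this]
    simp
  · let p := finProdFinEquiv.symm k
    let p' := finProdFinEquiv.symm k'
    -- With users as pairs (group, position), swap the two groups and, in every group, the two
    -- positions.
    refine ⟨(finProdFinEquiv.symm.trans ((Equiv.swap p.1 p'.1).prodCongr
      (Equiv.swap p.2 p'.2))).trans finProdFinEquiv, Equiv.swap p.1 p'.1, ?_, fun x => ?_⟩
    · change finProdFinEquiv (Equiv.swap p.1 p'.1 p.1, Equiv.swap p.2 p'.2 p.2) = k'
      rw [Equiv.swap_apply_left, Equiv.swap_apply_left]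
      exact finProdFinEquiv.apply_symm_apply k'
    · simp

lemma exists_design {tbar : ℕ} (h : Admissible K t tbar) :
    ∃ D : PTDesign K t, D.IsPairing ∧ GroupingTransitive D.Q ∧ D.FPT ≤ FJCM K t ∧
      D.FPT ≤ (∏ i ∈ range (tbar / 2), (2 * i + 1)) * K.choose t := by
  obtain ⟨hK, ⟨m, hm⟩, ⟨n, rfl⟩, h4, h2⟩ := h
  obtain rfl : K = m * 2 := by omega
  obtain ⟨Q, hQ, htr⟩ := exists_pairing m
  have hn : (n + n) / 2 = n := by omega
  rw [hn, FJCM]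
  -- For `n = 0`, that is `t = K`, one packet per label suffices. Otherwise the product of odd
  -- numbers is compared with `t`.
  rcases Nat.eq_zero_or_pos n with rfl | hn0
  · obtain ⟨D, hD, hD', hF⟩ := exists_design_all hQ htr (t := t) (c := 1) (by omega) one_pos
      (by omega) fun _ => rfl
    exact ⟨D, hD, hD', hF.trans (Nat.mul_le_mul_right _ (by omega)), by simpa using hF⟩
  rcases le_total (∏ i ∈ range n, (2 * i + 1)) t with hle | hle
  · obtain ⟨D, hD, hD', hF⟩ := exists_design_single hQ htr (t := t) (n := n) (by omega) (by omega)
    exact ⟨D, hD, hD', hF.trans (Nat.mul_le_mul_right _ hle), hF⟩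
  · obtain ⟨D, hD, hD', hF⟩ := exists_design_all hQ htr (t := t) (c := t) (by omega) (by omega)
      (fun _ => rfl) (by omega)
    exact ⟨D, hD, hD', hF, hF.trans (Nat.mul_le_mul_right _ hle)⟩

lemma prod_odd_eq (n : ℕ) :
    ((∏ i ∈ range n, (2 * i + 1) : ℕ) : ℝ) = ∏ i ∈ Finset.Icc 1 n, (2 * (i : ℝ) - 1) := by
  induction n with
  | zero => simp
  | succ n ih =>
    rw [prod_range_succ, prod_Icc_succ_top (by omega), ← ih]
    push_cast
    ring

end Designs

theorem theorem1 :
    ∃ FPT : ℕ → ℕ → ℕ,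
      (∀ K t tbar : ℕ, Admissible K t tbar →
        (∃ D : PTDesign K t, D.IsPairing ∧ D.FPT = FPT K t ∧
          ∀ (N : ℕ) (M : ℝ), 0 < N → (t : ℝ) = K * M / N →
            (D.scheme N).Achieves M (N / M - 1) (FPT K t)) ∧
        FPT K t ≤ FJCM K t ∧
        (FPT K t : ℝ) / FJCM K t ≤
          min (1 / (t : ℝ) * ∏ i ∈ Finset.Icc 1 (tbar / 2), (2 * (i : ℝ) - 1)) 1) ∧
      (∀ K t tbar : ℕ → ℕ, (∀ n, Admissible (K n) (t n) (tbar n)) →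
        Tendsto K atTop atTop →
        (fun n => 1 - (t n : ℝ) / K n) =O[atTop]
          (fun n => Real.logb 2 (Real.logb 2 (K n : ℝ)) / K n) →
        Tendsto (fun n => (FPT (K n) (t n) : ℝ) / FJCM (K n) (t n)) atTop (𝓝 0)) := by
  classical
  -- The value may depend on `K` and `t` only, which is harmless as they determine `tbar`; other
  -- pairs get the dummy value `0`.
  have hex : ∀ K t : ℕ, ∃ F : ℕ, ∀ tbar, Admissible K t tbar →
      ∃ D : PTDesign K t, D.FPT = F ∧ D.IsPairing ∧ GroupingTransitive D.Q ∧ F ≤ FJCM K t ∧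
        F ≤ (∏ i ∈ range (tbar / 2), (2 * i + 1)) * K.choose t := by
    intro K t
    by_cases h : ∃ tbar, Admissible K t tbar
    · obtain ⟨tbar, h⟩ := h
      obtain ⟨D, h1, h2, h3, h4⟩ := exists_design h
      refine ⟨D.FPT, fun tbar' h' => ⟨D, rfl, h1, h2, h3, ?_⟩⟩
      obtain rfl : tbar = tbar' := by
        have := h.1
        have := h'.1
        omega
      exact h4
    · exact ⟨0, fun tbar h' => absurd ⟨tbar, h'⟩ h⟩
  choose FPT hFPT using hex
  have hbound : ∀ K t tbar : ℕ, Admissible K t tbar →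
      (FPT K t : ℝ) / FJCM K t ≤
        min (1 / (t : ℝ) * ∏ i ∈ Finset.Icc 1 (tbar / 2), (2 * (i : ℝ) - 1)) 1 := by
    intro K t tbar h
    obtain ⟨_, _, _, _, h3, h4⟩ := hFPT K t tbar h
    obtain ⟨hK, -, -, h5, h6⟩ := h
    have ht : (0 : ℝ) < t := by exact_mod_cast (by omega : 0 < t)
    have hc : (0 : ℝ) < K.choose t := by exact_mod_cast Nat.choose_pos (by omega)
    have h3' : (FPT K t : ℝ) ≤ FJCM K t := by exact_mod_cast h3
    have h4' : (FPT K t : ℝ) ≤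
        ((∏ i ∈ range (tbar / 2), (2 * i + 1) : ℕ) : ℝ) * K.choose t := by exact_mod_cast h4
    rw [prod_odd_eq] at h4'
    refine le_min ?_ (div_le_one_of_le₀ h3' (Nat.cast_nonneg _))
    rw [FJCM, Nat.cast_mul, div_le_iff₀ (by positivity)]
    refine h4'.trans (le_of_eq ?_)
    field_simp
  refine ⟨FPT, fun K t tbar h => ⟨?_, ?_, hbound K t tbar h⟩, fun K t tbar hA hK hO => ?_⟩
  · obtain ⟨D, hF, h1, h2, -⟩ := hFPT K t tbar h
    obtain ⟨hK, -, -, h5, h6⟩ := h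
    refine ⟨D, h1, hF, fun N M hN hM => ?_⟩
    rw [← hF]
    exact D.scheme_achieves h2 (by omega) (by omega) hN hM
  · obtain ⟨_, _, _, _, h3, _⟩ := hFPT K t tbar h
    exact h3
  · exact tendsto_ratio_of_le hA hK hO (fun n => by positivity)
      fun n => (hbound _ _ _ (hA n)).trans (min_le_left _ _)
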